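/- Work in first-order logic without equality over a signature that has infinitely many constants (it may also have any function and predicate symbols). Formulas are built from atomic formulas, $\top$ and $\bot$ (which are not counted as atomic) by $\land,\lor,\supset,\exists,\forall$; formulas may contain free variables, and formulas that differ only in the names of bound variables are identified. A sequent $\Gamma\vdash\Delta$ is a pair of finite multisets of formulas. It is an axiom if $\top\in\Delta$, or if some $A$ that is $\bot$ or an atomic formula lies in both $\Gamma$ and $\Delta$. The inference rules (upper sequents $\Rightarrow$ lower sequent) are: - contr-L: $B,B,\Gamma\vdash\Delta\ \Rightarrow\ B,\Gamma\vdash\Delta$; contr-R: $\Gamma\vdash\Delta,B,B\ \Rightarrow\ \Gamma\vdash\Delta,B$; $\bot$-R: $\Gamma\vdash\Delta,\bot\ \Rightarrow\ \Gamma\vdash\Delta,D$; - $\land$-L: $B,\Gamma\vdash\Delta$ or $D,\Gamma\vdash\Delta\ \Rightarrow\ B\land D,\Gamma\vdash\Delta$; $\land$-R: $\Gamma\vdash\Delta,B$ and $\Gamma\vdash\Delta,D\ \Rightarrow\ \Gamma\vdash\Delta,B\land D$; - $\lor$-L: $B,\Gamma\vdash\Delta$ and $D,\Gamma\vdash\Delta\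 \Rightarrow\ B\lor D,\Gamma\vdash\Delta$; $\lor$-R: $\Gamma\vdash\Delta,B$ or $\Gamma\vdash\Delta,D\ \Rightarrow\ \Gamma\vdash\Delta,B\lor D$; - $\supset$-L: $\Gamma\vdash\Delta,B$ and $D,\Gamma\vdash\Theta\ \Rightarrow\ B\supset D,\Gamma\vdash\Delta,\Theta$; $\supset$-R: $B,\Gamma\vdash\Delta,D\ \Rightarrow\ \Gamma\vdash\Delta,B\supset D$; - $\forall$-L: $B[t/x],\Gamma\vdash\Delta\ \Rightarrow\ \forall x B,\Gamma\vdash\Delta$; $\exists$-R: $\Gamma\vdash\Delta,B[t/x]\ \Rightarrow\ \Gamma\vdash\Delta,\exists x B$, for any term $t$; - $\exists$-L: $B[c/x],\Gamma\vdash\Delta\ \Rightarrow\ \exists x B,\Gamma\vdash\Delta$; $\forall$-R: $\Gamma\vdash\Delta,B[c/x]\ \Rightarrow\ \Gamma\vdash\Delta,\forall x B$, for a constant $c$ that does not occur in the lower sequent. A $\mathbf{C}$-proof of a sequent is a finite derivation of it from axioms by these rules. An $\mathbf{I}$-proof is a $\mathbf{C}$-proof in which every sequent has exactly one formula in its succedent.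 **Theorem.** Let $\Gamma$ be a finite multiset of formulas and let $B_1,\ldots,B_n$ ($n\ge 1$) be formulas such that $\Gamma\vdash B_1,\ldots,B_n$ has a $\mathbf{C}$-proof in which no $\supset$-R and no $\forall$-L rule is used. Then, however the disjunction is bracketed, $\Gamma\vdash B_1\lor\cdots\lor B_n$ has an $\mathbf{I}$-proof in which no $\forall$-L rule is used. In particular, if $n=1$, then $\Gamma\vdash B_1$ itself has an $\mathbf{I}$-proof in which no $\forall$-L rule is used. -/

import Mathlib

universe u v

namespace SeqCalc

/-- First-order formulas over the signature `L`, without equality.  Variables are de Bruijn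
indices: under `k` quantifiers, the indices `0, …, k - 1` refer to the enclosing quantifiers
(innermost first) and the index `k + i` is the free variable number `i`. -/
inductive Fml (L : FirstOrder.Language.{u, v}) : Type (max u v)
  | top : Fml L
  | bot : Fml L
  | atom {k : ℕ} (R : L.Relations k) (ts : Fin k → L.Term ℕ) : Fml L
  | and (B D : Fml L) : Fml L
  | or (B D : Fml L) : Fml L
  | imp (B D : Fml L) : Fml L
  | ex (B : Fml L) : Fml L
  | all (B : Fml L) : Fml L

variable {L : FirstOrder.Language.{u, v}}

/-- Extension of a substitution to the scope of a quantifier: the bound variable is kept and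
the variables of the substituted terms are renamed so that they are not captured. -/
def liftSubst (σ : ℕ → L.Term ℕ) : ℕ → L.Term ℕ
  | 0 => FirstOrder.Language.Term.var 0
  | i + 1 => (σ i).relabel Nat.succ

/-- Simultaneous capture-avoiding substitution for the free variables. -/
def Fml.subst : Fml L → (ℕ → L.Term ℕ) → Fml L
  | .top, _ => .top
  | .bot, _ => .bot
  | .atom R ts, σ => .atom R fun i => (ts i).subst σ
  | .and B D, σ => .and (B.subst σ) (D.subst σ)
  | .or B D, σ => .or (B.subst σ) (D.subst σ)
  | .imp B D, σ => .imp (B.subst σ) (D.subst σ)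
  | .ex B, σ => .ex (B.subst (liftSubst σ))
  | .all B, σ => .all (B.subst (liftSubst σ))

/-- The substitution replacing the outermost bound variable of a quantifier body by `t`. -/
def instSubst (t : L.Term ℕ) : ℕ → L.Term ℕ
  | 0 => t
  | i + 1 => FirstOrder.Language.Term.var i

/-- `B[t/x]`, where `B` is the body of a formula `∀ x B` or `∃ x B`. -/
def Fml.inst (B : Fml L) (t : L.Term ℕ) : Fml L := B.subst (instSubst t)

/-- The constants (function symbols of arity `0`) that appear in a term. -/
def termConstants : L.Term ℕ → Set L.Constants
  | .var _ => ∅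
  | @FirstOrder.Language.Term.func _ _ k f ts =>
      {c | (⟨k, f⟩ : Σ n, L.Functions n) = ⟨0, c⟩} ∪ ⋃ i, termConstants (ts i)

/-- The constants that appear in a formula. -/
def Fml.constants : Fml L → Set L.Constants
  | .top => ∅
  | .bot => ∅
  | .atom _ ts => ⋃ i, termConstants (ts i)
  | .and B D => B.constants ∪ D.constants
  | .or B D => B.constants ∪ D.constants
  | .imp B D => B.constants ∪ D.constants
  | .ex B => B.constants
  | .all B => B.constants

/-- Sequents: pairs consisting of an antecedent and a succedent, both finite multisets. -/
@[ext]
structure Sequent (L : FirstOrder.Language.{u, v}) : Type (max u v) where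
  ant : Multiset (Fml L)
  suc : Multiset (Fml L)

/-- The constant `c` appears in no formula of the sequent. -/
def Sequent.Fresh (c : L.Constants) (s : Sequent L) : Prop :=
  (∀ F ∈ s.ant, c ∉ F.constants) ∧ ∀ F ∈ s.suc, c ∉ F.constants

/-- Axioms: `⊤` is in the succedent, or `⊥` or an atomic formula is on both sides. -/
def Sequent.IsAxiom (s : Sequent L) : Prop :=
  Fml.top ∈ s.suc ∨
  (Fml.bot ∈ s.ant ∧ Fml.bot ∈ s.suc) ∨
  ∃ (k : ℕ) (R : L.Relations k) (ts : Fin k → L.Term ℕ),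
    Fml.atom R ts ∈ s.ant ∧ Fml.atom R ts ∈ s.suc

/-- Names of the inference rule schemata. -/
inductive Rule : Type
  | contrL | contrR | botR | andL | andR | orL | orR | impL | impR | allL | allR | exL | exR

/-- `Step₁ r s' s`: the single upper sequent `s'` and the lower sequent `s` form an instance
of the rule schema `r`. -/
inductive Step₁ : Rule → Sequent L → Sequent L → Prop
  | contrL (Γ Δ : Multiset (Fml L)) (B : Fml L) :
      Step₁ .contrL ⟨B ::ₘ B ::ₘ Γ, Δ⟩ ⟨B ::ₘ Γ, Δ⟩
  | contrR (Γ Δ : Multiset (Fml L)) (B : Fml L) :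
      Step₁ .contrR ⟨Γ, B ::ₘ B ::ₘ Δ⟩ ⟨Γ, B ::ₘ Δ⟩
  | botR (Γ Δ : Multiset (Fml L)) (D : Fml L) :
      Step₁ .botR ⟨Γ, .bot ::ₘ Δ⟩ ⟨Γ, D ::ₘ Δ⟩
  | andL_left (Γ Δ : Multiset (Fml L)) (B D : Fml L) :
      Step₁ .andL ⟨B ::ₘ Γ, Δ⟩ ⟨B.and D ::ₘ Γ, Δ⟩
  | andL_right (Γ Δ : Multiset (Fml L)) (B D : Fml L) :
      Step₁ .andL ⟨D ::ₘ Γ, Δ⟩ ⟨B.and D ::ₘ Γ, Δ⟩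
  | orR_left (Γ Δ : Multiset (Fml L)) (B D : Fml L) :
      Step₁ .orR ⟨Γ, B ::ₘ Δ⟩ ⟨Γ, B.or D ::ₘ Δ⟩
  | orR_right (Γ Δ : Multiset (Fml L)) (B D : Fml L) :
      Step₁ .orR ⟨Γ, D ::ₘ Δ⟩ ⟨Γ, B.or D ::ₘ Δ⟩
  | impR (Γ Δ : Multiset (Fml L)) (B D : Fml L) :
      Step₁ .impR ⟨B ::ₘ Γ, D ::ₘ Δ⟩ ⟨Γ, B.imp D ::ₘ Δ⟩
  | allL (Γ Δ : Multiset (Fml L)) (B : Fml L) (t : L.Term ℕ) :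
      Step₁ .allL ⟨B.inst t ::ₘ Γ, Δ⟩ ⟨B.all ::ₘ Γ, Δ⟩
  | exR (Γ Δ : Multiset (Fml L)) (B : Fml L) (t : L.Term ℕ) :
      Step₁ .exR ⟨Γ, B.inst t ::ₘ Δ⟩ ⟨Γ, B.ex ::ₘ Δ⟩
  | exL (Γ Δ : Multiset (Fml L)) (B : Fml L) (c : L.Constants)
      (fresh : Sequent.Fresh c ⟨B.ex ::ₘ Γ, Δ⟩) :
      Step₁ .exL ⟨B.inst c.term ::ₘ Γ, Δ⟩ ⟨B.ex ::ₘ Γ, Δ⟩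
  | allR (Γ Δ : Multiset (Fml L)) (B : Fml L) (c : L.Constants)
      (fresh : Sequent.Fresh c ⟨Γ, B.all ::ₘ Δ⟩) :
      Step₁ .allR ⟨Γ, B.inst c.term ::ₘ Δ⟩ ⟨Γ, B.all ::ₘ Δ⟩

/-- `Step₂ r s₁ s₂ s`: the upper sequents `s₁`, `s₂` and the lower sequent `s` form an
instance of the rule schema `r`. -/
inductive Step₂ : Rule → Sequent L → Sequent L → Sequent L → Prop
  | orL (Γ Δ : Multiset (Fml L)) (B D : Fml L) :
      Step₂ .orL ⟨B ::ₘ Γ, Δ⟩ ⟨D ::ₘ Γ, Δ⟩ ⟨B.or D ::ₘ Γ, Δ⟩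
  | andR (Γ Δ : Multiset (Fml L)) (B D : Fml L) :
      Step₂ .andR ⟨Γ, B ::ₘ Δ⟩ ⟨Γ, D ::ₘ Δ⟩ ⟨Γ, B.and D ::ₘ Δ⟩
  | impL (Γ Δ Θ : Multiset (Fml L)) (B D : Fml L) :
      Step₂ .impL ⟨Γ, B ::ₘ Δ⟩ ⟨D ::ₘ Γ, Θ⟩ ⟨B.imp D ::ₘ Γ, Δ + Θ⟩

/-- **C**-proofs of a sequent: finite derivation trees making arbitrary use of the rules. -/
inductive CProof : Sequent L → Type (max u v)
  | ax {s : Sequent L} (h : s.IsAxiom) : CProof s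
  | one {s' s : Sequent L} (r : Rule) (h : Step₁ r s' s) (π : CProof s') : CProof s
  | two {s₁ s₂ s : Sequent L} (r : Rule) (h : Step₂ r s₁ s₂ s)
      (π₁ : CProof s₁) (π₂ : CProof s₂) : CProof s

/-- The rule schema `q` is used somewhere in the proof. -/
def CProof.Uses (q : Rule) : {s : Sequent L} → CProof s → Prop
  | _, .ax _ => False
  | _, .one r _ π => r = q ∨ π.Uses q
  | _, .two r _ π₁ π₂ => r = q ∨ π₁.Uses q ∨ π₂.Uses q

/-- **I**-proofs: **C**-proofs in which every sequent has exactly one formula in its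
succedent. -/
def CProof.IsIProof : {s : Sequent L} → CProof s → Prop
  | s, .ax _ => s.suc.card = 1
  | s, .one _ _ π => s.suc.card = 1 ∧ π.IsIProof
  | s, .two _ _ π₁ π₂ => s.suc.card = 1 ∧ π₁.IsIProof ∧ π₂.IsIProof

/-- `IsDisjunction [B₁, …, Bₙ] F`: the formula `F` is `B₁ ∨ … ∨ Bₙ`, with some placement of
the brackets (`n ≥ 1`; for `n = 1` it is `B₁`). -/
inductive IsDisjunction : List (Fml L) → Fml L → Prop
  | single (B : Fml L) : IsDisjunction [B] B
  | or {Bs Ds : List (Fml L)} {F G : Fml L} (hF : IsDisjunction Bs F)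
      (hG : IsDisjunction Ds G) : IsDisjunction (Bs ++ Ds) (F.or G)

end SeqCalc

namespace SeqCalc

open FirstOrder

variable {L : FirstOrder.Language.{u, v}}

/-! A classical proof without `⊃`-R and `∀`-L is constructively a case analysis: left rules split
the antecedent until each case derives one definite formula of the succedent (`CaseTree`,
`CProof.caseTree`). Right rules act only at the leaves, and a two-premise rule grafts one tree onto
the leaves of the other (`CaseTree.bind_fresh`). The critical rule is `∀`-R. Its eigenconstant must
still be fresh at the leaf where it is finally applied. This holds because the left rules that
remain add to the antecedent only subformulas and `∃`-L instances, whose constant can be chosen to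
avoid the eigenconstant; `∀`-L could introduce it. Injecting each leaf formula into the disjunction
makes the whole tree a single-succedent derivation (`CaseTree.derives`), which `Derives.iProvable`
turns into an **I**-proof. Permuting constants mediates between one eigenconstant and cofinitely
many. -/

/-! ### Renaming of constants -/

/-- The language map that permutes the constants and fixes all other symbols. -/
def permHom (p : Equiv.Perm L.Constants) : L →ᴸ L where
  onFunction {n} := match n with
    | 0 => fun f => p f
    | _ + 1 => fun f => f
  onRelation {_} R := R

/-- Renaming of the constants of a term. -/
def renTerm (p : Equiv.Perm L.Constants) (t : L.Term ℕ) : L.Term ℕ := (permHom p).onTerm t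

/-- Renaming of the constants of a formula. -/
def Fml.ren (p : Equiv.Perm L.Constants) : Fml L → Fml L
  | .top => .top
  | .bot => .bot
  | .atom R ts => .atom R fun i => renTerm p (ts i)
  | .and B D => .and (B.ren p) (D.ren p)
  | .or B D => .or (B.ren p) (D.ren p)
  | .imp B D => .imp (B.ren p) (D.ren p)
  | .ex B => .ex (B.ren p)
  | .all B => .all (B.ren p)

theorem renTerm_relabel (p : Equiv.Perm L.Constants) (g : ℕ → ℕ) (t : L.Term ℕ) :
    renTerm p (t.relabel g) = (renTerm p t).relabel g := by
  induction t with
  | var i => rfl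
  | func f ts ih =>
    simp only [renTerm, Language.Term.relabel, Language.LHom.onTerm] at ih ⊢
    congr 1
    funext i
    exact ih i

theorem renTerm_subst (p : Equiv.Perm L.Constants) (s : ℕ → L.Term ℕ) (t : L.Term ℕ) :
    renTerm p (t.subst s) = (renTerm p t).subst fun i => renTerm p (s i) := by
  induction t with
  | var i => rfl
  | func f ts ih =>
    simp only [renTerm, Language.Term.subst, Language.LHom.onTerm] at ih ⊢
    congr 1
    funext i
    exact ih i

theorem renTerm_liftSubst (p : Equiv.Perm L.Constants) (s : ℕ → L.Term ℕ) :
    (fun i => renTerm p (liftSubst s i)) = liftSubst fun i => renTerm p (s i) := by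
  funext i
  cases i with
  | zero => rfl
  | succ i => exact renTerm_relabel p _ _

theorem Fml.ren_subst (p : Equiv.Perm L.Constants) (B : Fml L) (s : ℕ → L.Term ℕ) :
    (B.subst s).ren p = (B.ren p).subst fun i => renTerm p (s i) := by
  induction B generalizing s with
  | top => rfl
  | bot => rfl
  | atom R ts => simp only [Fml.subst, Fml.ren, renTerm_subst]
  | and B D ihB ihD => simp only [Fml.subst, Fml.ren, ihB, ihD]
  | or B D ihB ihD => simp only [Fml.subst, Fml.ren, ihB, ihD]
  | imp B D ihB ihD => simp only [Fml.subst, Fml.ren, ihB, ihD]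
  | ex B ih => simp only [Fml.subst, Fml.ren, ih, renTerm_liftSubst]
  | all B ih => simp only [Fml.subst, Fml.ren, ih, renTerm_liftSubst]

theorem Fml.ren_inst (p : Equiv.Perm L.Constants) (B : Fml L) (t : L.Term ℕ) :
    (B.inst t).ren p = (B.ren p).inst (renTerm p t) := by
  rw [Fml.inst, Fml.ren_subst, Fml.inst]
  congr 1
  funext i
  cases i <;> rfl

theorem renTerm_constant (p : Equiv.Perm L.Constants) (c : L.Constants) :
    renTerm p c.term = (p c : L.Constants).term := by
  simp only [renTerm, Language.Constants.term, Language.LHom.onTerm]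
  congr 1
  funext i
  exact i.elim0

theorem renTerm_eq_self {p : Equiv.Perm L.Constants} {t : L.Term ℕ}
    (h : ∀ c ∈ termConstants t, p c = c) : renTerm p t = t := by
  induction t with
  | var i => rfl
  | @func k f ts ih =>
    have hf : (permHom p).onFunction f = f := by
      cases k with
      | zero => exact h f (Or.inl rfl)
      | succ k => rfl
    have hts : ∀ i, (permHom p).onTerm (ts i) = ts i := fun i =>
      ih i fun c hc => h c (Or.inr (Set.mem_iUnion.2 ⟨i, hc⟩))
    simp only [renTerm, Language.LHom.onTerm, hf, hts]

theorem Fml.ren_eq_self {p : Equiv.Perm L.Constants} {A : Fml L}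
    (h : ∀ c ∈ A.constants, p c = c) : A.ren p = A := by
  induction A with
  | top => rfl
  | bot => rfl
  | atom R ts =>
    have hts : ∀ i, renTerm p (ts i) = ts i := fun i =>
      renTerm_eq_self fun c hc => h c (Set.mem_iUnion.2 ⟨i, hc⟩)
    simp only [Fml.ren, hts]
  | and B D ihB ihD =>
    rw [Fml.ren, ihB fun c hc => h c (Or.inl hc), ihD fun c hc => h c (Or.inr hc)]
  | or B D ihB ihD =>
    rw [Fml.ren, ihB fun c hc => h c (Or.inl hc), ihD fun c hc => h c (Or.inr hc)]
  | imp B D ihB ihD =>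
    rw [Fml.ren, ihB fun c hc => h c (Or.inl hc), ihD fun c hc => h c (Or.inr hc)]
  | ex B ih => rw [Fml.ren, ih h]
  | all B ih => rw [Fml.ren, ih h]

open Classical in
theorem Fml.ren_swap {c d : L.Constants} {A : Fml L} (hc : c ∉ A.constants)
    (hd : d ∉ A.constants) : A.ren (Equiv.swap c d) = A :=
  Fml.ren_eq_self fun _ he => Equiv.swap_apply_of_ne_of_ne
    (fun h => hc (h ▸ he)) (fun h => hd (h ▸ he))

-- Carries a premise from its eigenconstant `c` to any other fresh `d`, which gives the cofinite
-- form of `∃`-L and `∀`-R.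
open Classical in
theorem Fml.ren_swap_inst {c d : L.Constants} {B : Fml L} (hc : c ∉ B.constants)
    (hd : d ∉ B.constants) : (B.inst c.term).ren (Equiv.swap c d) = B.inst d.term := by
  rw [Fml.ren_inst, Fml.ren_swap hc hd, renTerm_constant, Equiv.swap_apply_left]

open Classical in
theorem map_ren_swap {c d : L.Constants} {Γ : Multiset (Fml L)}
    (hc : ∀ F ∈ Γ, c ∉ F.constants) (hd : ∀ F ∈ Γ, d ∉ F.constants) :
    Γ.map (Fml.ren (Equiv.swap c d)) = Γ := by
  conv_rhs => rw [← Multiset.map_id Γ]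
  exact Multiset.map_congr rfl fun F hF => Fml.ren_swap (hc F hF) (hd F hF)

/-! ### Constants of terms and formulas -/

theorem termConstants_finite (t : L.Term ℕ) : (termConstants t).Finite := by
  induction t with
  | var i => exact Set.finite_empty
  | @func k f ts ih =>
    refine Set.Finite.union (Set.Subsingleton.finite ?_) (Set.finite_iUnion ih)
    intro c hc d hd
    have h : (⟨0, c⟩ : Σ n, L.Functions n) = ⟨0, d⟩ := Eq.trans (Eq.symm hc) hd
    simpa using h

theorem Fml.constants_finite (A : Fml L) : A.constants.Finite := by
  induction A with
  | top => exact Set.finite_empty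
  | bot => exact Set.finite_empty
  | atom R ts => exact Set.finite_iUnion fun i => termConstants_finite (ts i)
  | and B D ihB ihD => exact ihB.union ihD
  | or B D ihB ihD => exact ihB.union ihD
  | imp B D ihB ihD => exact ihB.union ihD
  | ex B ih => exact ih
  | all B ih => exact ih

/-- The constants that appear in some formula of a multiset. -/
def mconstants (Γ : Multiset (Fml L)) : Set L.Constants := ⋃ F ∈ Γ, F.constants

theorem notMem_mconstants {Γ : Multiset (Fml L)} {c : L.Constants} :
    c ∉ mconstants Γ ↔ ∀ F ∈ Γ, c ∉ F.constants := by
  simp [mconstants]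

theorem mconstants_finite (Γ : Multiset (Fml L)) : (mconstants Γ).Finite := by
  classical
  refine Set.Finite.subset (Γ.toFinset.finite_toSet.biUnion fun F _ => F.constants_finite) ?_
  simp [mconstants]

theorem termConstants_relabel (g : ℕ → ℕ) (t : L.Term ℕ) :
    termConstants (t.relabel g) = termConstants t := by
  induction t with
  | var i => rfl
  | func f ts ih => simp only [Language.Term.relabel, termConstants, ih]

theorem notMem_termConstants_subst {c : L.Constants} {s : ℕ → L.Term ℕ} {t : L.Term ℕ}
    (ht : c ∉ termConstants t) (hs : ∀ i, c ∉ termConstants (s i)) :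
    c ∉ termConstants (t.subst s) := by
  induction t with
  | var i => exact hs i
  | func f ts ih =>
    simp only [Language.Term.subst, termConstants, Set.mem_union, Set.mem_iUnion, not_or,
      not_exists] at ht ⊢
    exact ⟨ht.1, fun i => ih i (ht.2 i)⟩

theorem notMem_termConstants_liftSubst {c : L.Constants} {s : ℕ → L.Term ℕ}
    (hs : ∀ i, c ∉ termConstants (s i)) (i : ℕ) : c ∉ termConstants (liftSubst s i) := by
  cases i with
  | zero => exact id
  | succ i =>
    rw [liftSubst, termConstants_relabel]
    exact hs i

theorem Fml.notMem_constants_subst {c : L.Constants} {s : ℕ → L.Term ℕ} {A : Fml L}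
    (hA : c ∉ A.constants) (hs : ∀ i, c ∉ termConstants (s i)) :
    c ∉ (A.subst s).constants := by
  induction A generalizing s with
  | top => exact id
  | bot => exact id
  | atom R ts =>
    simp only [Fml.subst, Fml.constants, Set.mem_iUnion, not_exists] at hA ⊢
    exact fun i => notMem_termConstants_subst (hA i) hs
  | and B D ihB ihD =>
    exact not_or.2 ⟨ihB (fun h => hA (Or.inl h)) hs, ihD (fun h => hA (Or.inr h)) hs⟩
  | or B D ihB ihD =>
    exact not_or.2 ⟨ihB (fun h => hA (Or.inl h)) hs, ihD (fun h => hA (Or.inr h)) hs⟩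
  | imp B D ihB ihD =>
    exact not_or.2 ⟨ihB (fun h => hA (Or.inl h)) hs, ihD (fun h => hA (Or.inr h)) hs⟩
  | ex B ih => exact ih hA (notMem_termConstants_liftSubst hs)
  | all B ih => exact ih hA (notMem_termConstants_liftSubst hs)

theorem Fml.notMem_constants_inst {c d : L.Constants} {B : Fml L} (hB : c ∉ B.constants)
    (hcd : c ≠ d) : c ∉ (B.inst d.term).constants := by
  refine Fml.notMem_constants_subst hB fun i => ?_
  cases i with
  | zero =>
    simp only [instSubst, Language.Constants.term, termConstants, Set.mem_union,
      Set.mem_iUnion, not_or, not_exists]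
    refine ⟨fun h => hcd ?_, fun i => i.elim0⟩
    have h' : (⟨0, d⟩ : Σ n, L.Functions n) = ⟨0, c⟩ := h
    simpa using h'.symm
  | succ i => exact id

/-! ### A single-succedent calculus with built-in structural rules -/

/-- Derivability of a single formula, without `⊃`-R and `∀`-L.  Principal formulas of left rules
are kept, and the premises of `∃`-L and `∀`-R are required for all but finitely many
constants. -/
inductive Derives : Multiset (Fml L) → Fml L → Prop
  | top {Γ} : Derives Γ .top
  | bot {Γ} : Fml.bot ∈ Γ → Derives Γ .bot
  | atom {Γ} {k : ℕ} {R : L.Relations k} {ts : Fin k → L.Term ℕ} :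
      Fml.atom R ts ∈ Γ → Derives Γ (.atom R ts)
  | botR {Γ D} : Derives Γ .bot → Derives Γ D
  | andL_left {Γ A B D} : Fml.and B D ∈ Γ → Derives (B ::ₘ Γ) A → Derives Γ A
  | andL_right {Γ A B D} : Fml.and B D ∈ Γ → Derives (D ::ₘ Γ) A → Derives Γ A
  | andR {Γ B D} : Derives Γ B → Derives Γ D → Derives Γ (.and B D)
  | orL {Γ A B D} : Fml.or B D ∈ Γ → Derives (B ::ₘ Γ) A → Derives (D ::ₘ Γ) A → Derives Γ A
  | orR_left {Γ B D} : Derives Γ B → Derives Γ (.or B D)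
  | orR_right {Γ B D} : Derives Γ D → Derives Γ (.or B D)
  | impL {Γ A B D} : Fml.imp B D ∈ Γ → Derives Γ B → Derives (D ::ₘ Γ) A → Derives Γ A
  | exR {Γ B} (t : L.Term ℕ) : Derives Γ (B.inst t) → Derives Γ (.ex B)
  | exL {Γ A B} {S : Set L.Constants} (hS : S.Finite) : Fml.ex B ∈ Γ →
      (∀ c : L.Constants, c ∉ S → Derives (B.inst c.term ::ₘ Γ) A) → Derives Γ A
  | allR {Γ B} {S : Set L.Constants} (hS : S.Finite) :
      (∀ c : L.Constants, c ∉ S → Derives Γ (B.inst c.term)) → Derives Γ (.all B)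

/-- Since `⊆` ignores multiplicity, this is both weakening and contraction. Eigenconstants need no
renaming: the exceptional set `S` need not contain the constants of the antecedent. -/
theorem Derives.mono {Γ Γ' : Multiset (Fml L)} {A : Fml L} (h : Derives Γ A) (hΓ : Γ ⊆ Γ') :
    Derives Γ' A := by
  induction h generalizing Γ' with
  | top => exact .top
  | bot h => exact .bot (hΓ h)
  | atom h => exact .atom (hΓ h)
  | botR _ ih => exact .botR (ih hΓ)
  | andL_left h _ ih => exact .andL_left (hΓ h) (ih (Multiset.cons_subset_cons hΓ))
  | andL_right h _ ih => exact .andL_right (hΓ h) (ih (Multiset.cons_subset_cons hΓ))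
  | andR _ _ ih₁ ih₂ => exact .andR (ih₁ hΓ) (ih₂ hΓ)
  | orL h _ _ ih₁ ih₂ =>
    exact .orL (hΓ h) (ih₁ (Multiset.cons_subset_cons hΓ)) (ih₂ (Multiset.cons_subset_cons hΓ))
  | orR_left _ ih => exact .orR_left (ih hΓ)
  | orR_right _ ih => exact .orR_right (ih hΓ)
  | impL h _ _ ih₁ ih₂ => exact .impL (hΓ h) (ih₁ hΓ) (ih₂ (Multiset.cons_subset_cons hΓ))
  | exR t _ ih => exact .exR t (ih hΓ)
  | exL hS h _ ih => exact .exL hS (hΓ h) fun c hc => ih c hc (Multiset.cons_subset_cons hΓ)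
  | allR hS _ ih => exact .allR hS fun c hc => ih c hc hΓ

theorem Derives.ren (p : Equiv.Perm L.Constants) {Γ : Multiset (Fml L)} {A : Fml L}
    (h : Derives Γ A) : Derives (Γ.map (Fml.ren p)) (A.ren p) := by
  induction h with
  | top => exact .top
  | bot h => exact .bot (Multiset.mem_map_of_mem (Fml.ren p) h)
  | atom h => exact .atom (Multiset.mem_map_of_mem (Fml.ren p) h)
  | botR _ ih => exact .botR ih
  | andL_left h _ ih =>
    rw [Multiset.map_cons] at ih
    exact .andL_left (Multiset.mem_map_of_mem (Fml.ren p) h) ih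
  | andL_right h _ ih =>
    rw [Multiset.map_cons] at ih
    exact .andL_right (Multiset.mem_map_of_mem (Fml.ren p) h) ih
  | andR _ _ ih₁ ih₂ => exact .andR ih₁ ih₂
  | orL h _ _ ih₁ ih₂ =>
    rw [Multiset.map_cons] at ih₁ ih₂
    exact .orL (Multiset.mem_map_of_mem (Fml.ren p) h) ih₁ ih₂
  | orR_left _ ih => exact .orR_left ih
  | orR_right _ ih => exact .orR_right ih
  | impL h _ _ ih₁ ih₂ =>
    rw [Multiset.map_cons] at ih₂
    exact .impL (Multiset.mem_map_of_mem (Fml.ren p) h) ih₁ ih₂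
  | exR t _ ih =>
    rw [Fml.ren_inst] at ih
    exact .exR _ ih
  | @exL Γ A B S hS h _ ih =>
    refine .exL (hS.image p) (Multiset.mem_map_of_mem (Fml.ren p) h) fun c hc => ?_
    -- The premise at `c` is the renaming of the premise at `p.symm c`.
    have := ih (p.symm c) fun h' => hc ⟨_, h', p.apply_symm_apply c⟩
    rwa [Multiset.map_cons, Fml.ren_inst, renTerm_constant, p.apply_symm_apply] at this
  | @allR Γ B S hS _ ih =>
    refine .allR (hS.image p) fun c hc => ?_
    have := ih (p.symm c) fun h' => hc ⟨_, h', p.apply_symm_apply c⟩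
    rwa [Fml.ren_inst, renTerm_constant, p.apply_symm_apply] at this

/-- `∀`-R with a single fresh constant. -/
theorem Derives.allR_of_fresh {Γ : Multiset (Fml L)} {B : Fml L} {c : L.Constants}
    (hΓ : ∀ F ∈ Γ, c ∉ F.constants) (hB : c ∉ B.constants) (h : Derives Γ (B.inst c.term)) :
    Derives Γ (.all B) := by
  classical
  refine .allR ((mconstants_finite Γ).union B.constants_finite) fun d hd => ?_
  obtain ⟨hdΓ, hdB⟩ := not_or.1 hd
  have := h.ren (Equiv.swap c d)
  rwa [map_ren_swap hΓ (notMem_mconstants.1 hdΓ), Fml.ren_swap_inst hB hdB] at this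

/-! ### Case analyses -/

/-- `CaseTree Δ Γ`: by left rules, the antecedent `Γ` splits into finitely many cases, in each of
which some formula of `Δ` is derivable. -/
inductive CaseTree (Δ : Multiset (Fml L)) : Multiset (Fml L) → Prop
  | leaf {Γ A} : A ∈ Δ → Derives Γ A → CaseTree Δ Γ
  | andL_left {Γ B D} : Fml.and B D ∈ Γ → CaseTree Δ (B ::ₘ Γ) → CaseTree Δ Γ
  | andL_right {Γ B D} : Fml.and B D ∈ Γ → CaseTree Δ (D ::ₘ Γ) → CaseTree Δ Γ
  | orL {Γ B D} : Fml.or B D ∈ Γ → CaseTree Δ (B ::ₘ Γ) → CaseTree Δ (D ::ₘ Γ) → CaseTree Δ Γ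
  | impL {Γ B D} : Fml.imp B D ∈ Γ → Derives Γ B → CaseTree Δ (D ::ₘ Γ) → CaseTree Δ Γ
  | exL {Γ B} {S : Set L.Constants} (hS : S.Finite) : Fml.ex B ∈ Γ →
      (∀ c : L.Constants, c ∉ S → CaseTree Δ (B.inst c.term ::ₘ Γ)) → CaseTree Δ Γ

theorem CaseTree.mono {Δ Γ Γ' : Multiset (Fml L)} (h : CaseTree Δ Γ) (hΓ : Γ ⊆ Γ') :
    CaseTree Δ Γ' := by
  induction h generalizing Γ' with
  | leaf hA h => exact .leaf hA (h.mono hΓ)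
  | andL_left h _ ih => exact .andL_left (hΓ h) (ih (Multiset.cons_subset_cons hΓ))
  | andL_right h _ ih => exact .andL_right (hΓ h) (ih (Multiset.cons_subset_cons hΓ))
  | orL h _ _ ih₁ ih₂ =>
    exact .orL (hΓ h) (ih₁ (Multiset.cons_subset_cons hΓ)) (ih₂ (Multiset.cons_subset_cons hΓ))
  | impL h hB _ ih => exact .impL (hΓ h) (hB.mono hΓ) (ih (Multiset.cons_subset_cons hΓ))
  | exL hS h _ ih => exact .exL hS (hΓ h) fun c hc => ih c hc (Multiset.cons_subset_cons hΓ)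

theorem CaseTree.ren (p : Equiv.Perm L.Constants) {Δ Γ : Multiset (Fml L)} (h : CaseTree Δ Γ) :
    CaseTree (Δ.map (Fml.ren p)) (Γ.map (Fml.ren p)) := by
  induction h with
  | leaf hA h => exact .leaf (Multiset.mem_map_of_mem (Fml.ren p) hA) (h.ren p)
  | andL_left h _ ih =>
    rw [Multiset.map_cons] at ih
    exact .andL_left (Multiset.mem_map_of_mem (Fml.ren p) h) ih
  | andL_right h _ ih =>
    rw [Multiset.map_cons] at ih
    exact .andL_right (Multiset.mem_map_of_mem (Fml.ren p) h) ih
  | orL h _ _ ih₁ ih₂ =>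
    rw [Multiset.map_cons] at ih₁ ih₂
    exact .orL (Multiset.mem_map_of_mem (Fml.ren p) h) ih₁ ih₂
  | impL h hB _ ih =>
    rw [Multiset.map_cons] at ih
    exact .impL (Multiset.mem_map_of_mem (Fml.ren p) h) (hB.ren p) ih
  | @exL Γ B S hS h _ ih =>
    refine .exL (hS.image p) (Multiset.mem_map_of_mem (Fml.ren p) h) fun c hc => ?_
    have := ih (p.symm c) fun h' => hc ⟨_, h', p.apply_symm_apply c⟩
    rwa [Multiset.map_cons, Fml.ren_inst, renTerm_constant, p.apply_symm_apply] at this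

/-- Grafting of case analyses at the leaves of a case analysis; the constants of a finite set `T`
that do not occur in the antecedent may be assumed not to occur at the leaves either. -/
theorem CaseTree.bind_fresh {Δ Δ' Γ : Multiset (Fml L)} {T : Set L.Constants} (hT : T.Finite)
    (h : CaseTree Δ Γ) (hΓ : ∀ c ∈ T, ∀ F ∈ Γ, c ∉ F.constants)
    (graft : ∀ Γ', Γ ⊆ Γ' → (∀ c ∈ T, ∀ F ∈ Γ', c ∉ F.constants) →
      ∀ A ∈ Δ, Derives Γ' A → CaseTree Δ' Γ') :
    CaseTree Δ' Γ := by
  have sub : ∀ {B : Fml L} {Γ Γ' : Multiset (Fml L)}, B ::ₘ Γ ⊆ Γ' → Γ ⊆ Γ' :=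
    fun h => Multiset.Subset.trans (Multiset.subset_cons _ _) h
  -- Propositional left rules add only subformulas of formulas already present, so they introduce no
  -- constant.
  have fresh : ∀ {B : Fml L} {Γ : Multiset (Fml L)}, (∀ c ∈ T, ∀ F ∈ Γ, c ∉ F.constants) →
      (∀ c ∈ T, c ∉ B.constants) → ∀ c ∈ T, ∀ F ∈ B ::ₘ Γ, c ∉ F.constants :=
    fun hΓ hB c hc => Multiset.forall_mem_cons.2 ⟨hB c hc, hΓ c hc⟩
  induction h with
  | leaf hA h => exact graft _ (Multiset.Subset.refl _) hΓ _ hA h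
  | andL_left h _ ih =>
    exact .andL_left h (ih (fresh hΓ fun c hc h' => hΓ c hc _ h (Or.inl h'))
      fun Γ' h' => graft Γ' (sub h'))
  | andL_right h _ ih =>
    exact .andL_right h (ih (fresh hΓ fun c hc h' => hΓ c hc _ h (Or.inr h'))
      fun Γ' h' => graft Γ' (sub h'))
  | orL h _ _ ih₁ ih₂ =>
    exact .orL h
      (ih₁ (fresh hΓ fun c hc h' => hΓ c hc _ h (Or.inl h')) fun Γ' h' => graft Γ' (sub h'))
      (ih₂ (fresh hΓ fun c hc h' => hΓ c hc _ h (Or.inr h')) fun Γ' h' => graft Γ' (sub h'))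
  | impL h hB _ ih =>
    exact .impL h hB (ih (fresh hΓ fun c hc h' => hΓ c hc _ h (Or.inr h'))
      fun Γ' h' => graft Γ' (sub h'))
  | @exL Γ B S hS h _ ih =>
    -- Enlarging the exceptional set by `T` keeps the witness `d` out of `T`.
    refine .exL (hS.union hT) h fun d hd => ?_
    obtain ⟨hdS, hdT⟩ := not_or.1 hd
    exact ih d hdS
      (fresh hΓ fun c hc => Fml.notMem_constants_inst (hΓ c hc B.ex h) fun e => hdT (e ▸ hc))
      fun Γ' h' => graft Γ' (sub h')

theorem CaseTree.bind {Δ Δ' Γ : Multiset (Fml L)} (h : CaseTree Δ Γ)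
    (graft : ∀ Γ', Γ ⊆ Γ' → ∀ A ∈ Δ, Derives Γ' A → CaseTree Δ' Γ') : CaseTree Δ' Γ :=
  h.bind_fresh Set.finite_empty (fun _ hc => hc.elim) fun Γ' h' _ => graft Γ' h'

/-- Replacement of a formula of the succedent by a consequence. -/
theorem CaseTree.map_head {Δ Γ : Multiset (Fml L)} {A B : Fml L} (h : CaseTree (A ::ₘ Δ) Γ)
    (hAB : ∀ Γ', Derives Γ' A → Derives Γ' B) : CaseTree (B ::ₘ Δ) Γ := by
  refine h.bind fun Γ' _ C hC hd => ?_
  rcases Multiset.mem_cons.1 hC with rfl | hC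
  · exact .leaf (Multiset.mem_cons_self _ _) (hAB _ hd)
  · exact .leaf (Multiset.mem_cons_of_mem hC) hd

/-- `∃`-L with a single fresh constant. -/
theorem CaseTree.exL_of_fresh {Δ Γ : Multiset (Fml L)} {B : Fml L} {c : L.Constants}
    (hΓ : ∀ F ∈ Γ, c ∉ F.constants) (hΔ : ∀ F ∈ Δ, c ∉ F.constants) (hB : c ∉ B.constants)
    (h : CaseTree Δ (B.inst c.term ::ₘ Γ)) : CaseTree Δ (B.ex ::ₘ Γ) := by
  classical
  refine .exL (((mconstants_finite Γ).union (mconstants_finite Δ)).union B.constants_finite)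
    (Multiset.mem_cons_self _ _) fun d hd => ?_
  obtain ⟨hd, hdB⟩ := not_or.1 hd
  obtain ⟨hdΓ, hdΔ⟩ := not_or.1 hd
  -- The swap must fix `Δ` as well, since the leaves derive formulas of `Δ`.
  have := h.ren (Equiv.swap c d)
  rw [Multiset.map_cons, map_ren_swap hΓ (notMem_mconstants.1 hdΓ),
    map_ren_swap hΔ (notMem_mconstants.1 hdΔ), Fml.ren_swap_inst hB hdB] at this
  exact this.mono (Multiset.cons_subset_cons (Multiset.subset_cons _ _))

/-- Grafting with `T = {c}` keeps `c` out of the antecedents of the leaves, so `∀`-R applies at each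
leaf that derives the instance. Freshness in `Δ` is irrelevant because a leaf derives a single
formula. -/
theorem CaseTree.allR_of_fresh {Δ Γ : Multiset (Fml L)} {B : Fml L} {c : L.Constants}
    (hΓ : ∀ F ∈ Γ, c ∉ F.constants) (hB : c ∉ B.constants)
    (h : CaseTree (B.inst c.term ::ₘ Δ) Γ) : CaseTree (B.all ::ₘ Δ) Γ := by
  refine h.bind_fresh (Set.finite_singleton c) (fun _ hd => hd ▸ hΓ) fun Γ' _ hΓ' A hA hd => ?_
  rcases Multiset.mem_cons.1 hA with rfl | hA
  · exact .leaf (Multiset.mem_cons_self _ _) (hd.allR_of_fresh (hΓ' c rfl) hB)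
  · exact .leaf (Multiset.mem_cons_of_mem hA) hd

theorem CaseTree.of_isAxiom {s : Sequent L} (h : s.IsAxiom) : CaseTree s.suc s.ant := by
  rcases h with h | ⟨h₁, h₂⟩ | ⟨k, R, ts, h₁, h₂⟩
  · exact .leaf h .top
  · exact .leaf h₂ (.bot h₁)
  · exact .leaf h₂ (.atom h₁)

/-- `⊃`-R fails here: a leaf deriving a side formula could depend on the antecedent of the
implication, with nothing to discharge it. -/
theorem CaseTree.step₁ {r : Rule} {s' s : Sequent L} (h : Step₁ r s' s) (hi : r ≠ .impR)
    (ha : r ≠ .allL) (ih : CaseTree s'.suc s'.ant) : CaseTree s.suc s.ant := by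
  cases h with
  | contrL Γ Δ B =>
    exact ih.mono (Multiset.cons_subset.2 ⟨Multiset.mem_cons_self _ _, Multiset.Subset.refl _⟩)
  | contrR Γ Δ B =>
    exact ih.bind fun Γ' _ A hA hd => .leaf (by simpa using hA) hd
  | botR Γ Δ D => exact ih.map_head fun _ => .botR
  | andL_left Γ Δ B D =>
    exact .andL_left (Multiset.mem_cons_self _ _)
      (ih.mono (Multiset.cons_subset_cons (Multiset.subset_cons _ _)))
  | andL_right Γ Δ B D =>
    exact .andL_right (Multiset.mem_cons_self _ _)
      (ih.mono (Multiset.cons_subset_cons (Multiset.subset_cons _ _)))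
  | orR_left Γ Δ B D => exact ih.map_head fun _ => .orR_left
  | orR_right Γ Δ B D => exact ih.map_head fun _ => .orR_right
  | impR => exact absurd rfl hi
  | allL => exact absurd rfl ha
  | exR Γ Δ B t => exact ih.map_head fun _ => .exR t
  | exL Γ Δ B c fresh =>
    obtain ⟨hB, hΓ⟩ := Multiset.forall_mem_cons.1 fresh.1
    exact ih.exL_of_fresh hΓ fresh.2 hB
  | allR Γ Δ B c fresh =>
    exact ih.allR_of_fresh fresh.1 (Multiset.forall_mem_cons.1 fresh.2).1

theorem CaseTree.step₂ {r : Rule} {s₁ s₂ s : Sequent L} (h : Step₂ r s₁ s₂ s)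
    (ih₁ : CaseTree s₁.suc s₁.ant) (ih₂ : CaseTree s₂.suc s₂.ant) : CaseTree s.suc s.ant := by
  cases h with
  | orL Γ Δ B D =>
    exact .orL (Multiset.mem_cons_self _ _)
      (ih₁.mono (Multiset.cons_subset_cons (Multiset.subset_cons _ _)))
      (ih₂.mono (Multiset.cons_subset_cons (Multiset.subset_cons _ _)))
  | andR Γ Δ B D =>
    -- The second tree is grafted onto the leaves of the first that derive `B`; where it then
    -- derives `D`, both conjuncts are available.
    refine ih₁.bind fun Γ' h₁ A hA hB => ?_
    rcases Multiset.mem_cons.1 hA with rfl | hA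
    · refine (ih₂.mono h₁).bind fun Γ'' h₂ A' hA' hD => ?_
      rcases Multiset.mem_cons.1 hA' with rfl | hA'
      · exact .leaf (Multiset.mem_cons_self _ _) (.andR (hB.mono h₂) hD)
      · exact .leaf (Multiset.mem_cons_of_mem hA') hD
    · exact .leaf (Multiset.mem_cons_of_mem hA) hB
  | impL Γ Δ Θ B D =>
    -- A leaf deriving `B` becomes an `impL` node, with the second tree above its `D` branch; other
    -- leaves already derive a formula of `Δ`.
    refine (ih₁.mono (Multiset.subset_cons Γ (B.imp D))).bind fun Γ' h₁ A hA hB => ?_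
    rcases Multiset.mem_cons.1 hA with rfl | hA
    · refine .impL (h₁ (Multiset.mem_cons_self _ _)) hB ?_
      refine (ih₂.mono (Multiset.cons_subset_cons
        (Multiset.Subset.trans (Multiset.subset_cons _ _) h₁))).bind fun Γ'' _ A' hA' hd => ?_
      exact .leaf (Multiset.mem_add.2 (Or.inr hA')) hd
    · exact .leaf (Multiset.mem_add.2 (Or.inl hA)) hB

theorem CProof.caseTree {s : Sequent L} (π : CProof s) (hi : ¬ π.Uses .impR)
    (ha : ¬ π.Uses .allL) : CaseTree s.suc s.ant := by
  induction π with
  | ax h => exact .of_isAxiom h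
  | one r h π ih =>
    obtain ⟨hi₀, hi⟩ := not_or.1 hi
    obtain ⟨ha₀, ha⟩ := not_or.1 ha
    exact .step₁ h hi₀ ha₀ (ih hi ha)
  | two r h π₁ π₂ ih₁ ih₂ =>
    obtain ⟨-, hi⟩ := not_or.1 hi
    obtain ⟨-, ha⟩ := not_or.1 ha
    exact .step₂ h (ih₁ (not_or.1 hi).1 (not_or.1 ha).1) (ih₂ (not_or.1 hi).2 (not_or.1 ha).2)

/-- Every node of the tree is a left rule of `Derives`, so only the leaves change. `hF` ranges over
all antecedents because those at the leaves have grown. -/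
theorem CaseTree.derives {Δ Γ : Multiset (Fml L)} {F : Fml L} (h : CaseTree Δ Γ)
    (hF : ∀ A ∈ Δ, ∀ Γ', Derives Γ' A → Derives Γ' F) : Derives Γ F := by
  induction h with
  | leaf hA h => exact hF _ hA _ h
  | andL_left h _ ih => exact .andL_left h ih
  | andL_right h _ ih => exact .andL_right h ih
  | orL h _ _ ih₁ ih₂ => exact .orL h ih₁ ih₂
  | impL h hB _ ih => exact .impL h hB ih
  | exL hS h _ ih => exact .exL hS h ih

theorem IsDisjunction.derives {Bs : List (Fml L)} {F : Fml L} (h : IsDisjunction Bs F) :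
    ∀ A ∈ Bs, ∀ Γ, Derives Γ A → Derives Γ F := by
  induction h with
  | single B =>
    intro A hA Γ hd
    rwa [List.mem_singleton.1 hA] at hd
  | or _ _ ihF ihG =>
    intro A hA Γ hd
    rcases List.mem_append.1 hA with hA | hA
    · exact .orR_left (ihF A hA Γ hd)
    · exact .orR_right (ihG A hA Γ hd)

/-! ### Back to **I**-proofs -/

/-- The sequent has an **I**-proof without `∀`-L. -/
def IProvable (s : Sequent L) : Prop := ∃ ρ : CProof s, ρ.IsIProof ∧ ¬ ρ.Uses .allL

theorem IProvable.ax {Γ : Multiset (Fml L)} {A : Fml L} (h : Sequent.IsAxiom ⟨Γ, {A}⟩) :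
    IProvable ⟨Γ, {A}⟩ :=
  ⟨.ax h, Multiset.card_singleton A, id⟩

theorem IProvable.one {r : Rule} {s' : Sequent L} {Γ : Multiset (Fml L)} {A : Fml L}
    (h : Step₁ r s' ⟨Γ, {A}⟩) (hr : r ≠ .allL) : IProvable s' → IProvable ⟨Γ, {A}⟩ :=
  fun ⟨ρ, h₁, h₂⟩ => ⟨.one r h ρ, ⟨Multiset.card_singleton A, h₁⟩, not_or.2 ⟨hr, h₂⟩⟩

theorem IProvable.two {r : Rule} {s₁ s₂ : Sequent L} {Γ : Multiset (Fml L)} {A : Fml L}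
    (h : Step₂ r s₁ s₂ ⟨Γ, {A}⟩) (hr : r ≠ .allL) :
    IProvable s₁ → IProvable s₂ → IProvable ⟨Γ, {A}⟩ :=
  fun ⟨ρ₁, h₁, h₂⟩ ⟨ρ₂, h₃, h₄⟩ => ⟨.two r h ρ₁ ρ₂, ⟨Multiset.card_singleton A, h₁, h₃⟩,
    not_or.2 ⟨hr, not_or.2 ⟨h₂, h₄⟩⟩⟩

/-- Contraction of a formula that occurs in the antecedent. -/
theorem IProvable.contract {Γ : Multiset (Fml L)} {A B : Fml L} (hB : B ∈ Γ)
    (h : IProvable ⟨B ::ₘ Γ, {A}⟩) : IProvable ⟨Γ, {A}⟩ := by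
  obtain ⟨Γ₀, rfl⟩ := Multiset.exists_cons_of_mem hB
  exact .one (.contrL Γ₀ {A} B) nofun h

theorem IProvable.impL {Γ : Multiset (Fml L)} {A B D : Fml L} (h₁ : IProvable ⟨Γ, {B}⟩)
    (h₂ : IProvable ⟨D ::ₘ Γ, {A}⟩) : IProvable ⟨B.imp D ::ₘ Γ, {A}⟩ := by
  -- With `Δ` empty, both premises and the conclusion have one succedent formula.
  have h := Step₂.impL Γ 0 {A} B D
  rw [zero_add] at h
  exact .two h nofun h₁ h₂

/-- Kept principal formulas are absorbed by contr-L, and axioms allow any context, so weakening is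
not needed. Infinitely many constants guarantee an eigenconstant outside the exceptional set and the
sequent. -/
theorem Derives.iProvable [Infinite L.Constants] {Γ : Multiset (Fml L)} {A : Fml L}
    (h : Derives Γ A) : IProvable ⟨Γ, {A}⟩ := by
  induction h with
  | top => exact .ax (Or.inl (Multiset.mem_singleton_self _))
  | bot h => exact .ax (Or.inr (Or.inl ⟨h, Multiset.mem_singleton_self _⟩))
  | atom h => exact .ax (Or.inr (Or.inr ⟨_, _, _, h, Multiset.mem_singleton_self _⟩))
  -- The remaining succedent is `0` because `{D}` unfolds to `D ::ₘ 0`.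
  | @botR Γ D _ ih => exact .one (.botR Γ 0 D) nofun ih
  | @andL_left Γ A B D h _ ih => exact .contract h (.one (.andL_left Γ {A} B D) nofun ih)
  | @andL_right Γ A B D h _ ih => exact .contract h (.one (.andL_right Γ {A} B D) nofun ih)
  | @andR Γ B D _ _ ih₁ ih₂ => exact .two (.andR Γ 0 B D) nofun ih₁ ih₂
  | @orL Γ A B D h _ _ ih₁ ih₂ => exact .contract h (.two (.orL Γ {A} B D) nofun ih₁ ih₂)
  | @orR_left Γ B D _ ih => exact .one (.orR_left Γ 0 B D) nofun ih
  | @orR_right Γ B D _ ih => exact .one (.orR_right Γ 0 B D) nofun ih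
  | impL h _ _ ih₁ ih₂ => exact .contract h (.impL ih₁ ih₂)
  | @exR Γ B t _ ih => exact .one (.exR Γ 0 B t) nofun ih
  | @exL Γ A B S hS h _ ih =>
    obtain ⟨c, hc⟩ := ((hS.union (mconstants_finite Γ)).union A.constants_finite).exists_notMem
    obtain ⟨hc, hcA⟩ := not_or.1 hc
    obtain ⟨hcS, hcΓ⟩ := not_or.1 hc
    have hΓ := notMem_mconstants.1 hcΓ
    exact .contract h (.one (.exL Γ {A} B c ⟨Multiset.forall_mem_cons.2 ⟨hΓ _ h, hΓ⟩,
      fun F hF => Multiset.mem_singleton.1 hF ▸ hcA⟩) nofun (ih c hcS))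
  | @allR Γ B S hS _ ih =>
    obtain ⟨c, hc⟩ := ((hS.union (mconstants_finite Γ)).union B.constants_finite).exists_notMem
    obtain ⟨hc, hcB⟩ := not_or.1 hc
    obtain ⟨hcS, hcΓ⟩ := not_or.1 hc
    exact .one (.allR Γ 0 B c ⟨notMem_mconstants.1 hcΓ,
      fun F hF => (Multiset.mem_singleton.1 hF).symm ▸ hcB⟩) nofun (ih c hcS)

theorem CProof.iProvable_disjunction [Infinite L.Constants] {Γ : Multiset (Fml L)}
    {Bs : List (Fml L)} (π : CProof ⟨Γ, ↑Bs⟩) (hi : ¬ π.Uses .impR) (ha : ¬ π.Uses .allL)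
    {F : Fml L} (hF : IsDisjunction Bs F) : IProvable ⟨Γ, {F}⟩ :=
  ((π.caseTree hi ha).derives fun A hA => hF.derives A (Multiset.mem_coe.1 hA)).iProvable

end SeqCalc

theorem mainTheorem6 {L : FirstOrder.Language.{u, v}} [Infinite L.Constants]
    (Γ : Multiset (SeqCalc.Fml L)) :
    (∀ (Bs : List (SeqCalc.Fml L)) (π : SeqCalc.CProof (L := L) ⟨Γ, ↑Bs⟩),
      ¬ π.Uses SeqCalc.Rule.impR → ¬ π.Uses SeqCalc.Rule.allL →
      ∀ F : SeqCalc.Fml L, SeqCalc.IsDisjunction Bs F →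
        ∃ ρ : SeqCalc.CProof (L := L) ⟨Γ, {F}⟩,
          ρ.IsIProof ∧ ¬ ρ.Uses SeqCalc.Rule.allL) ∧
    (∀ (B : SeqCalc.Fml L) (π : SeqCalc.CProof (L := L) ⟨Γ, {B}⟩),
      ¬ π.Uses SeqCalc.Rule.impR → ¬ π.Uses SeqCalc.Rule.allL →
        ∃ ρ : SeqCalc.CProof (L := L) ⟨Γ, {B}⟩,
          ρ.IsIProof ∧ ¬ ρ.Uses SeqCalc.Rule.allL) := by
  exact ⟨fun _ π hi ha _ hF => π.iProvable_disjunction hi ha hF,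
    fun B π hi ha => π.iProvable_disjunction (Bs := [B]) hi ha (.single B)⟩
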